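/- All graphs are finite, simple and undirected. For a graph $G$ let $\rho(G)$ be the largest eigenvalue of its adjacency matrix and $\delta(G)$ its minimum degree. A graph $G$ is said to contain a strong parity factor if for every set $X\subseteq V(G)$ with $|X|$ even, $G$ has a spanning subgraph $F$ with $\delta(F)\ge 1$ such that $d_F(u)$ is odd for every $u\in X$ and $d_F(v)$ is even for every $v\in V(G)\setminus X$. Here $K_m$ is the complete graph on $m$ vertices, $\cup$ denotes disjoint union, $tK_1$ is the graph with $t$ vertices and no edges, and the join $G_1\vee G_2$ is obtained from $G_1\cup G_2$ by adding all edges between $V(G_1)$ and $V(G_2)$. Theorem. Let $G$ be a connected graph of order $n$ with minimum degree $\delta$, where $\delta\ge 3$ and $n\ge 2\delta^2$. If $$\rho(G)\ \ge\ \rho\bigl(K_\delta\vee(K_{n-\delta(\delta-1)-1}\cup(\delta(\delta-2)+1)K_1)\bigr),$$ then $G$ contains a strong parity factor or $G$ is isomorphic to $K_\delta\vee(K_{n-\delta(\delta-1)-1}\cup(\delta(\delta-2)+1)K_1)$. -/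

import Mathlib

namespace StrongParity

open SimpleGraph

/-- The join of two vertex-disjoint graphs: their disjoint union together with all edges between
the two vertex sets. -/
def join {V W : Type*} (G : SimpleGraph V) (H : SimpleGraph W) : SimpleGraph (V ⊕ W) :=
  (G ⊕g H) ⊔ completeBipartiteGraph V W

open Classical in
/-- The (adjacency) spectral radius of a finite graph: the largest eigenvalue of its real
adjacency matrix. -/
noncomputable def rho {V : Type*} [Fintype V] (G : SimpleGraph V) : ℝ :=
  sSup {μ : ℝ | Module.End.HasEigenvalue (Matrix.toLin' (G.adjMatrix ℝ)) μ}

open Classical in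
/-- The supremum defining `rho` is a maximum as soon as the graph has a vertex. -/
theorem rho_isGreatest {V : Type*} [Fintype V] [Nonempty V] (G : SimpleGraph V) :
    IsGreatest {μ : ℝ | Module.End.HasEigenvalue (Matrix.toLin' (G.adjMatrix ℝ)) μ} (rho G) := by
  have hset : {μ : ℝ | Module.End.HasEigenvalue (Matrix.toLin' (G.adjMatrix ℝ)) μ}
      = Set.range (isHermitian_adjMatrix ℝ (G := G)).eigenvalues := by
    rw [← Matrix.IsHermitian.spectrum_real_eq_range_eigenvalues]
    ext μ
    rw [Set.mem_ofPred_eq, Module.End.hasEigenvalue_iff_mem_spectrum, Matrix.spectrum_toLin']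
  unfold rho
  rw [hset]
  have hfin := Set.finite_range (isHermitian_adjMatrix ℝ (G := G)).eigenvalues
  have hne := Set.range_nonempty (isHermitian_adjMatrix ℝ (G := G)).eigenvalues
  exact ⟨hne.csSup_mem hfin, fun x hx => le_csSup hfin.bddAbove hx⟩

open Classical in
/-- `G` has a strong parity factor: for every vertex set `X` of even size there is a spanning
subgraph `F` of `G` without isolated vertices in which exactly the vertices of `X` have odd
degree. -/
def HasStrongParityFactor {V : Type*} [Fintype V] (G : SimpleGraph V) : Prop :=
  ∀ X : Finset V, Even X.card →
    ∃ F : SimpleGraph V, F ≤ G ∧ (∀ v, 1 ≤ F.degree v) ∧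
      (∀ u ∈ X, Odd (F.degree u)) ∧ (∀ v ∉ X, Even (F.degree v))

/-- The graph `K_δ ∨ (K_{n - δ(δ-1) - 1} ∪ (δ(δ-2)+1) K_1)`. It is used only for `3 ≤ δ` and
`2 * δ ^ 2 ≤ n`, where no subtraction is truncated and the order is `n`. -/
def extremalGraph (n δ : ℕ) :
    SimpleGraph (Fin δ ⊕ (Fin (n - δ * (δ - 1) - 1) ⊕ Fin (δ * (δ - 2) + 1))) :=
  join (completeGraph (Fin δ))
    (completeGraph (Fin (n - δ * (δ - 1) - 1)) ⊕g (⊥ : SimpleGraph (Fin (δ * (δ - 2) + 1))))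

end StrongParity

namespace StrongParity

open SimpleGraph

/-! Write m = (δ - 1)². The extremal graph contains a clique of order n - m, so its spectral radius
is at least n - m - 1. A graph `G` without a strong parity factor turns out to have all degrees
below n - m - 1, hence a smaller spectral radius. So the hypothesis always forces the factor, and
the isomorphism alternative never has to be invoked.

For the degree bound, fix a bad set X and encode the required subgraphs as perfect matchings of
`gadget`. An inclusion-minimal Tutte violator there has a rigid shape, which descends to a vertex
set T of `G` such that G - T has at least ∑ (d(v) - 2) + 2 components, the sum being over T
(`exists_separated_of_not_hasStrongParityFactor`). By the minimum degree, a component is either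
large or sends many edges to T, and T has few edges to offer. So the components have many vertices
in total, and no vertex is adjacent to almost all others (`degree_lt_of_separated`). -/

/-- The graph obtained from `G` by removing every edge with an end in `S`. -/
def isolate {V : Type*} (G : SimpleGraph V) (S : Set V) : SimpleGraph V where
  Adj x y := G.Adj x y ∧ x ∉ S ∧ y ∉ S
  symm := ⟨fun _ _ h => ⟨h.1.symm, h.2.2, h.2.1⟩⟩
  loopless := ⟨fun _ h => h.1.ne rfl⟩

/-- The vertices reachable from `x` in `G - S`. -/
def reachSet {V : Type*} (G : SimpleGraph V) (S : Set V) (x : V) : Set V :=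
  {y | (isolate G S).Reachable x y}

/-- The vertex sets of the odd components of `G - S`. -/
def oddParts {V : Type*} (G : SimpleGraph V) (S : Set V) : Set (Set V) :=
  {C | Odd C.ncard ∧ ∃ x ∉ S, C = reachSet G S x}

/-! ### Odd components and minimal Tutte violators -/

section Deletion

variable {V : Type*} {G : SimpleGraph V} {S : Set V}

lemma mem_reachSet_self (x : V) : x ∈ reachSet G S x := Reachable.refl x

lemma reachSet_eq_of_mem {x y : V} (h : y ∈ reachSet G S x) : reachSet G S y = reachSet G S x := by
  ext z
  exact ⟨fun hz => Reachable.trans h hz, fun hz => Reachable.trans (Reachable.symm h) hz⟩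

lemma mem_reachSet_of_adj {x y z : V} (h : y ∈ reachSet G S x) (hyz : G.Adj y z) (hy : y ∉ S)
    (hz : z ∉ S) : z ∈ reachSet G S x :=
  Reachable.trans h (Adj.reachable (G := isolate G S) ⟨hyz, hy, hz⟩)

/-- A set containing `x` and closed under adjacency outside `S` contains `reachSet G S x`. -/
lemma reachSet_subset {x : V} {C : Set V} (hx : x ∈ C)
    (hC : ∀ y ∈ C, ∀ z, G.Adj y z → y ∉ S → z ∉ S → z ∈ C) : reachSet G S x ⊆ C := by
  rintro y ⟨p⟩
  induction p with
  | nil => exact hx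
  | cons h p ih => exact ih (hC _ hx _ h.1 h.2.1 h.2.2)

lemma notMem_of_mem_reachSet {x y : V} (hx : x ∉ S) (h : y ∈ reachSet G S x) : y ∉ S :=
  reachSet_subset (C := Sᶜ) hx (fun _ _ _ _ _ hz => hz) h

lemma deleteVerts_reachable_iff {a b : ((⊤ : G.Subgraph).deleteVerts S).verts} :
    ((⊤ : G.Subgraph).deleteVerts S).coe.Reachable a b ↔ b.1 ∈ reachSet G S a.1 := by
  constructor
  · intro h
    let f : ((⊤ : G.Subgraph).deleteVerts S).coe →g isolate G S :=
      ⟨Subtype.val, fun {x y} hxy => by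
        have := hxy
        simp only [Subgraph.coe_adj, Subgraph.deleteVerts_adj, Subgraph.top_adj] at this
        exact ⟨this.2.2.2.2, this.2.1, this.2.2.2.1⟩⟩
    exact h.map f
  · intro h
    have key : reachSet G S a.1 ⊆ {y | ∃ hy : y ∈ ((⊤ : G.Subgraph).deleteVerts S).verts,
        ((⊤ : G.Subgraph).deleteVerts S).coe.Reachable a ⟨y, hy⟩} := by
      refine reachSet_subset ⟨a.2, Reachable.refl _⟩ ?_
      rintro y ⟨hy, hay⟩ z hyz hyS hzS
      have hz : z ∈ ((⊤ : G.Subgraph).deleteVerts S).verts := by simpa using hzS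
      refine ⟨hz, hay.trans (Adj.reachable ?_)⟩
      simp [hyz, hyS, hzS]
    exact (key h).2

/-- Moves Tutte's count from a graph on a subtype to subsets of `V`, so that components for
different `S` can be compared. -/
lemma ncard_oddComponents_deleteVerts :
    ((⊤ : G.Subgraph).deleteVerts S).coe.oddComponents.ncard = (oddParts G S).ncard := by
  have himage : ∀ a : ((⊤ : G.Subgraph).deleteVerts S).verts,
      Subtype.val '' (((⊤ : G.Subgraph).deleteVerts S).coe.connectedComponentMk a).supp
        = reachSet G S a.1 := by
    intro a
    ext y
    simp only [Set.mem_image, ConnectedComponent.mem_supp_iff, ConnectedComponent.eq]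
    constructor
    · rintro ⟨b, hb, rfl⟩
      exact deleteVerts_reachable_iff.1 hb.symm
    · intro hy
      have ha : a.1 ∉ S := by simpa using a.2
      have hyS := notMem_of_mem_reachSet ha hy
      exact ⟨⟨y, by simpa using hyS⟩, (deleteVerts_reachable_iff.2 hy).symm, rfl⟩
  have hinj : Function.Injective
      (fun c : ((⊤ : G.Subgraph).deleteVerts S).coe.ConnectedComponent =>
        (Subtype.val '' c.supp : Set V)) := fun c d hcd =>
    ConnectedComponent.supp_injective (Set.image_injective.2 Subtype.val_injective hcd)
  rw [← Set.ncard_image_of_injective _ hinj]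
  congr 1
  ext C
  constructor
  · rintro ⟨c, hc, rfl⟩
    refine ⟨?_, ?_⟩
    · rw [Set.ncard_image_of_injective _ Subtype.val_injective]
      exact hc
    · induction c using ConnectedComponent.ind with
      | _ a => exact ⟨a.1, by simpa using a.2, himage a⟩
  · rintro ⟨hodd, x, hx, rfl⟩
    refine ⟨((⊤ : G.Subgraph).deleteVerts S).coe.connectedComponentMk ⟨x, by simpa using hx⟩,
      ?_, himage _⟩
    have := himage ⟨x, by simpa using hx⟩
    rw [← this, Set.ncard_image_of_injective _ Subtype.val_injective] at hodd
    exact hodd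

/-- In a graph of even order, a Tutte violator `S` leaves at least `|S| + 2` odd components. -/
lemma two_le_of_isTutteViolator [Finite V] (heven : Even (Nat.card V))
    (h : G.IsTutteViolator S) : S.ncard + 2 ≤ (oddParts G S).ncard := by
  unfold IsTutteViolator at h
  have hpar := ((⊤ : G.Subgraph).deleteVerts S).coe.odd_ncard_oddComponents
  rw [ncard_oddComponents_deleteVerts] at h hpar
  have hcard : Nat.card ((⊤ : G.Subgraph).deleteVerts S).verts + S.ncard = Nat.card V := by
    rw [Nat.card_coe_set_eq, ← Set.ncard_add_ncard_compl S, add_comm]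
    congr 2
    ext; simp
  -- The number of odd components has the parity of |V| - |S|, hence of |S|, so an excess of exactly
  -- 1 is impossible.
  by_contra hlt
  have : (oddParts G S).ncard = S.ncard + 1 := by omega
  rw [this] at hpar
  rw [← hcard] at heven
  rcases Nat.even_or_odd S.ncard with hs | hs
  · have := hpar.1 hs.add_one
    exact (Nat.not_even_iff_odd.2 (this.add_even hs)) heven
  · have h1 : ¬ Odd (Nat.card ((⊤ : G.Subgraph).deleteVerts S).verts) := fun h' => by
      have := hpar.2 h'
      grind
    exact (Nat.not_even_iff_odd.2 ((Nat.not_odd_iff_even.1 h1).add_odd hs)) heven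

/-- Every vertex of an inclusion-minimal Tutte violator `S` has neighbours in three odd
components of `G - S`. -/
lemma three_le_of_minimal [Finite V] (heven : Even (Nat.card V))
    (h : Minimal G.IsTutteViolator S) {p : V} (hp : p ∈ S) :
    3 ≤ {C ∈ oddParts G S | ∃ y ∈ C, G.Adj p y}.ncard := by
  by_contra hlt
  have hviol : G.IsTutteViolator (S \ {p}) := by
    unfold IsTutteViolator
    rw [ncard_oddComponents_deleteVerts]
    have h1 := two_le_of_isTutteViolator heven h.prop
    -- Putting `p` back leaves untouched every odd component without a neighbour of `p`. If at most
    -- two are lost, at least |S| remain, more than |S \ {p}|.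
    have h2 : oddParts G S \ {C ∈ oddParts G S | ∃ y ∈ C, G.Adj p y} ⊆ oddParts G (S \ {p}) := by
      rintro C ⟨⟨hodd, x, hx, rfl⟩, hC⟩
      refine ⟨hodd, x, fun hx' => hx hx'.1, Set.Subset.antisymm ?_ ?_⟩
      · refine reachSet_subset (mem_reachSet_self x) fun y hy z hyz hyS hzS => ?_
        exact mem_reachSet_of_adj hy hyz (fun h' => hyS h'.1) (fun h' => hzS h'.1)
      · refine reachSet_subset (mem_reachSet_self x) fun y hy z hyz hyS hzS => ?_
        refine mem_reachSet_of_adj hy hyz (notMem_of_mem_reachSet hx hy) fun hz => ?_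
        have : z = p := by
          by_contra hne
          exact hzS ⟨hz, hne⟩
        subst this
        exact hC ⟨⟨hodd, x, hx, rfl⟩, y, hy, hyz.symm⟩
    have h3 := Set.ncard_le_ncard h2
    have h4 := Set.ncard_sdiff_add_ncard_of_subset (s := {C ∈ oddParts G S | ∃ y ∈ C, G.Adj p y})
      (t := oddParts G S) (Set.sep_subset _ _)
    have h5 := Set.ncard_sdiff_singleton_lt_of_mem hp
    omega
  exact (h.le_of_le hviol Set.sdiff_subset hp).2 rfl

end Deletion

/-! ### Reduction of degree-constrained factors to perfect matchings -/

/-- The graph whose perfect matchings encode the spanning subgraphs `F` of `G` in which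
`G.degree v - F.degree v` is at most `k v` and of the same parity as `k v`: each vertex `v` is
replaced by its darts together with a clique of order `k v` joined to all of them, and each edge
joins its two darts. -/
def gadget {V : Type*} (G : SimpleGraph V) (k : V → ℕ) :
    SimpleGraph (G.Dart ⊕ (Σ v, Fin (k v))) where
  Adj
    | .inl d, .inl e => e = d.symm
    | .inl d, .inr q => q.1 = d.fst
    | .inr q, .inl d => q.1 = d.fst
    | .inr q, .inr r => q ≠ r ∧ q.1 = r.1
  symm := ⟨by
    rintro (d | q) (e | r) h
    · simpa using (congrArg Dart.symm h).symm
    · exact h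
    · exact h
    · exact ⟨h.1.symm, h.2.symm⟩⟩
  loopless := ⟨by
    rintro (d | q) h
    · exact d.symm_ne h.symm
    · exact h.1 rfl⟩

section Gadget

variable {V : Type*} {G : SimpleGraph V} {k : V → ℕ}

@[simp] lemma gadget_inl_inl {d e : G.Dart} :
    (gadget G k).Adj (.inl d) (.inl e) ↔ e = d.symm := Iff.rfl

@[simp] lemma gadget_inl_inr {d : G.Dart} {q : Σ v, Fin (k v)} :
    (gadget G k).Adj (.inl d) (.inr q) ↔ q.1 = d.fst := Iff.rfl

@[simp] lemma gadget_inr_inl {d : G.Dart} {q : Σ v, Fin (k v)} :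
    (gadget G k).Adj (.inr q) (.inl d) ↔ q.1 = d.fst := Iff.rfl

@[simp] lemma gadget_inr_inr {q r : Σ v, Fin (k v)} :
    (gadget G k).Adj (.inr q) (.inr r) ↔ q ≠ r ∧ q.1 = r.1 := Iff.rfl

/-- A finite set with a fixed-point free involution has even cardinality. -/
lemma even_card_of_involution {α : Type*} [DecidableEq α] (s : Finset α) (f : α → α)
    (hmem : ∀ a ∈ s, f a ∈ s) (hne : ∀ a ∈ s, f a ≠ a) (hinv : ∀ a ∈ s, f (f a) = a) :
    Even s.card := by
  have h : ∑ _a ∈ s, (1 : ZMod 2) = 0 :=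
    Finset.sum_involution (fun a _ => f a) (fun _ _ => by decide) (fun a ha _ => hne a ha)
      (fun a ha => hmem a ha) (fun a ha => hinv a ha)
  rw [Finset.sum_const, nsmul_eq_mul, mul_one] at h
  exact (ZMod.natCast_eq_zero_iff_even).1 h

open Classical in
lemma card_darts_fst [Fintype V] (v : V) :
    (Finset.univ.filter fun d : G.Dart => d.fst = v).card = G.degree v := by
  have h := G.dart_fst_fiber_card_eq_degree v
  convert h using 2

open Classical in
/-- A perfect matching of the gadget yields a spanning subgraph with the prescribed degrees. -/
theorem exists_factor_of_isPerfectMatching [Fintype V] {M : (gadget G k).Subgraph}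
    (hM : M.IsPerfectMatching) :
    ∃ F ≤ G, ∀ v, G.degree v ≤ F.degree v + k v ∧ Even (G.degree v + F.degree v + k v) := by
  choose mate hmate hmate' using fun x => hM.1 (hM.2 x)
  have hadj : ∀ x, (gadget G k).Adj x (mate x) := fun x => (hmate x).adj_sub
  have hinv : ∀ x, mate (mate x) = x := fun x => (hmate' _ _ (hmate x).symm).symm
  obtain ⟨F, hF⟩ : ∃ F : SimpleGraph V, ∀ u v, F.Adj u v ↔
      ∃ h : G.Adj u v, mate (.inl ⟨(u, v), h⟩) = .inl (⟨(u, v), h⟩ : G.Dart).symm := ⟨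
    { Adj := fun u v => ∃ h : G.Adj u v, mate (.inl ⟨(u, v), h⟩) = .inl (⟨(u, v), h⟩ : G.Dart).symm
      symm := ⟨fun u v ⟨h, hm⟩ => ⟨h.symm, by
        have := hinv (.inl ⟨(u, v), h⟩)
        rw [hm] at this
        exact this⟩⟩
      loopless := ⟨fun u ⟨h, _⟩ => h.ne rfl⟩ }, fun _ _ => Iff.rfl⟩
  have hFG : F ≤ G := fun u v h => ((hF u v).1 h).1
  refine ⟨F, hFG, fun v => ?_⟩
  -- At `v`, the darts in `A` are matched to their reverses and are the edges of `F`; those in `B`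
  -- are matched into the clique of `v`.
  set A : Finset G.Dart := Finset.univ.filter fun d => d.fst = v ∧ mate (.inl d) = .inl d.symm
    with hA
  set B : Finset G.Dart := Finset.univ.filter fun d => d.fst = v ∧ mate (.inl d) ≠ .inl d.symm
    with hB
  have hAcard : A.card = F.degree v := by
    rw [← card_neighborFinset_eq_degree]
    refine Finset.card_bij (fun d _ => d.snd) ?_ ?_ ?_
    · rintro ⟨⟨a, b⟩, h⟩ hd
      simp only [hA, Finset.mem_filter, Finset.mem_univ, true_and] at hd
      obtain ⟨rfl, hd⟩ := hd
      simp only [mem_neighborFinset]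
      exact (hF _ _).2 ⟨h, hd⟩
    · rintro ⟨⟨a, b⟩, h⟩ hd ⟨⟨a', b'⟩, h'⟩ hd' hbb
      simp only [hA, Finset.mem_filter, Finset.mem_univ, true_and] at hd hd'
      ext
      · exact hd.1.trans hd'.1.symm
      · exact hbb
    · intro b hb
      rw [mem_neighborFinset, hF] at hb
      obtain ⟨h, hm⟩ := hb
      exact ⟨⟨(v, b), h⟩, by simpa [hA] using hm, rfl⟩
  have hAB : A.card + B.card = G.degree v := by
    rw [← card_darts_fst v, hA, hB, ← Finset.filter_filter, ← Finset.filter_filter]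
    exact Finset.card_filter_add_card_filter_not _
  have hBmate : ∀ d ∈ B, ∃ i : Fin (k v), mate (.inl d) = .inr ⟨v, i⟩ := by
    intro d hd
    simp only [hB, Finset.mem_filter, Finset.mem_univ, true_and] at hd
    have h := hadj (.inl d)
    rcases hm : mate (.inl d) with e | ⟨w, i⟩
    · rw [hm] at h
      exact absurd (hm.trans (congrArg Sum.inl h)) hd.2
    · rw [hm] at h
      obtain rfl : w = v := h.trans hd.1
      exact ⟨i, rfl⟩
  set Q : Finset (Σ v, Fin (k v)) := Finset.univ.image (Sigma.mk v) with hQ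
  have hQcard : Q.card = k v := by
    rw [hQ, Finset.card_image_of_injective _ sigma_mk_injective, Finset.card_univ,
      Fintype.card_fin]
  have hBQ : B.card ≤ k v := by
    have hmateinj : Function.Injective mate := Function.LeftInverse.injective hinv
    rw [← hQcard, ← Finset.card_map (Function.Embedding.inl (β := Σ v, Fin (k v))),
      ← Finset.card_map (s := Q) (Function.Embedding.inr (α := G.Dart))]
    refine Finset.card_le_card_of_injOn mate ?_ hmateinj.injOn
    intro x hx
    obtain ⟨d, hd, rfl⟩ := Finset.mem_map.1 hx
    obtain ⟨i, hi⟩ := hBmate d hd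
    exact Finset.mem_map.2 ⟨⟨v, i⟩, by simp [hQ], hi.symm⟩
  -- `B` together with the clique of `v` is closed under the matching, which acts on it as a
  -- fixed-point free involution.
  have heven : Even (B.card + k v) := by
    rw [← hQcard, ← Finset.card_disjSum]
    refine even_card_of_involution _ mate ?_ (fun x _ => (hadj x).ne') (fun x _ => hinv x)
    rintro (d | ⟨w, i⟩) hx
    · rw [Finset.inl_mem_disjSum] at hx
      obtain ⟨i, hi⟩ := hBmate d hx
      rw [hi, Finset.inr_mem_disjSum]
      simp [hQ]
    · rw [Finset.inr_mem_disjSum] at hx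
      obtain rfl : v = w := by
        simp only [hQ, Finset.mem_image, Finset.mem_univ, true_and] at hx
        obtain ⟨j, hj⟩ := hx
        exact congrArg Sigma.fst hj
      have h := hadj (.inr ⟨v, i⟩)
      rcases hm : mate (.inr ⟨v, i⟩) with e | ⟨w, j⟩
      · rw [hm] at h
        have h' := hinv (.inr ⟨v, i⟩)
        rw [hm] at h'
        rw [Finset.inl_mem_disjSum]
        simp only [hB, Finset.mem_filter, Finset.mem_univ, true_and]
        refine ⟨Eq.symm h, ?_⟩
        rw [h']
        simp
      · rw [hm] at h
        obtain rfl : v = w := h.2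
        rw [Finset.inr_mem_disjSum]
        simp [hQ]
  constructor
  · omega
  · grind

open Classical in
lemma card_gadget [Fintype V] :
    Nat.card (G.Dart ⊕ (Σ v, Fin (k v))) = ∑ v, (G.degree v + k v) := by
  rw [Nat.card_eq_fintype_card, Fintype.card_sum, Fintype.card_sigma, Finset.sum_add_distrib,
    ← G.sum_degrees_eq_twice_card_edges.trans G.dart_card_eq_twice_card_edges.symm]
  simp

end Gadget

/-! ### From a Tutte violator of the gadget to a vertex cut of `G` -/

section Separation

variable {V : Type*}

/-- Contrapositive form of `three_le_of_minimal`: a vertex that sees at most two components cannot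
lie in a minimal violator. `∅` serves as a dummy when one component suffices. -/
lemma notMem_of_minimal [Finite V] {G : SimpleGraph V} {S : Set V} (heven : Even (Nat.card V))
    (h : Minimal G.IsTutteViolator S) {p : V} (A B : Set V)
    (hp : ∀ y ∉ S, G.Adj p y → reachSet G S y = A ∨ reachSet G S y = B) : p ∉ S := by
  intro hpS
  have h3 := three_le_of_minimal heven h hpS
  have hsub : {C ∈ oddParts G S | ∃ y ∈ C, G.Adj p y} ⊆ {A, B} := by
    rintro C ⟨⟨_, x, hx, rfl⟩, y, hy, hpy⟩
    rw [← reachSet_eq_of_mem hy]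
    exact hp y (notMem_of_mem_reachSet hx hy) hpy
  have := (Set.ncard_le_ncard hsub).trans (Set.ncard_insert_le A {B})
  rw [Set.ncard_singleton] at this
  omega

/-- If the gadget of `G` has no perfect matching, some vertex set `T` leaves at least
`∑ v ∈ T, k v + 2` components. -/
theorem exists_separated_of_not_isPerfectMatching [Fintype V] {G : SimpleGraph V} {k : V → ℕ}
    (heven : Even (Nat.card (G.Dart ⊕ (Σ v, Fin (k v)))))
    (h : ¬ ∃ M : (gadget G k).Subgraph, M.IsPerfectMatching) :
    ∃ T R : Finset V, Disjoint R T ∧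
      (∀ r ∈ R, ∀ r' ∈ R, r' ∈ reachSet G T r → r = r') ∧ ∑ v ∈ T, k v + 2 ≤ R.card := by
  classical
  rw [tutte] at h
  push Not at h
  obtain ⟨U₀, hU₀⟩ := h
  obtain ⟨U, -, hU⟩ := exists_minimal_le_of_wellFoundedLT (gadget G k).IsTutteViolator U₀ hU₀
  have hcard := two_le_of_isTutteViolator heven hU.prop
  have hreach : ∀ {x y}, (gadget G k).Adj x y → x ∉ U → y ∉ U →
      reachSet (gadget G k) U y = reachSet (gadget G k) U x := fun hxy hx hy =>
    reachSet_eq_of_mem (mem_reachSet_of_adj (mem_reachSet_self _) hxy hx hy)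
  have hclique : ∀ v (i j : Fin (k v)), Sum.inr ⟨v, i⟩ ∉ U → Sum.inr ⟨v, j⟩ ∉ U →
      reachSet (gadget G k) U (.inr ⟨v, i⟩) = reachSet (gadget G k) U (.inr ⟨v, j⟩) := by
    intro v i j hi hj
    by_cases hij : i = j
    · rw [hij]
    · exact hreach (by simpa using Ne.symm hij) hj hi
  -- A dart sees only its reverse and one clique, whose surviving vertices share a component.
  have hdart : ∀ d : G.Dart, Sum.inl d ∉ U := by
    intro d
    by_cases hq : ∃ i : Fin (k d.fst), Sum.inr ⟨d.fst, i⟩ ∉ U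
    · obtain ⟨i, hi⟩ := hq
      refine notMem_of_minimal heven hU (reachSet (gadget G k) U (.inl d.symm))
        (reachSet (gadget G k) U (.inr ⟨d.fst, i⟩)) ?_
      rintro (e | ⟨w, j⟩) hy hadj
      · left; rw [gadget_inl_inl.1 hadj]
      · right
        obtain rfl : w = d.fst := hadj
        exact hclique _ _ _ hy hi
    · push Not at hq
      refine notMem_of_minimal heven hU (reachSet (gadget G k) U (.inl d.symm)) ∅ ?_
      rintro (e | ⟨w, j⟩) hy hadj
      · left; rw [gadget_inl_inl.1 hadj]
      · obtain rfl : w = d.fst := hadj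
        exact absurd (hq j) hy
  -- All neighbours of a clique vertex are adjacent or equal to any surviving vertex of that clique,
  -- so a clique lies in `U` entirely or not at all.
  have hall : ∀ v (i j : Fin (k v)), Sum.inr ⟨v, j⟩ ∉ U → Sum.inr ⟨v, i⟩ ∉ U := by
    intro v i j hj
    refine notMem_of_minimal heven hU (reachSet (gadget G k) U (.inr ⟨v, j⟩)) ∅ ?_
    rintro (e | ⟨w, l⟩) hy hadj
    · left
      exact hreach hadj hj hy
    · left
      obtain rfl : v = w := hadj.2
      exact hclique _ _ _ hy hj
  -- A vertex with `k v = 0` belongs to `T` vacuously.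
  set T : Finset V := Finset.univ.filter fun v => ∀ i : Fin (k v), Sum.inr ⟨v, i⟩ ∈ U with hT
  have hmemT : ∀ v, v ∈ T ↔ ∀ i : Fin (k v), Sum.inr ⟨v, i⟩ ∈ U := by simp [hT]
  have hnotT : ∀ v ∉ T, ∃ i : Fin (k v), Sum.inr ⟨v, i⟩ ∉ U := by
    intro v hv
    rw [hmemT] at hv
    push Not at hv
    exact hv
  have hrep : ∀ C ∈ oddParts (gadget G k) U, ∃ v ∉ T, ∃ i : Fin (k v), Sum.inr ⟨v, i⟩ ∈ C := by
    have hfst : ∀ C ∈ oddParts (gadget G k) U, ∀ d : G.Dart, Sum.inl d ∈ C → d.fst ∉ T →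
        ∃ v ∉ T, ∃ i : Fin (k v), Sum.inr ⟨v, i⟩ ∈ C := by
      rintro C ⟨_, x, hx, rfl⟩ d hd hdT
      obtain ⟨i, hi⟩ := hnotT _ hdT
      exact ⟨d.fst, hdT, i, mem_reachSet_of_adj hd (by simp) (hdart d) hi⟩
    intro C hC
    have hC' := hC
    obtain ⟨hodd, x, hx, rfl⟩ := hC'
    rcases x with d | ⟨v, i⟩
    · by_cases h1 : d.fst ∈ T
      · have hds : Sum.inl d.symm ∈ reachSet (gadget G k) U (.inl d) :=
          mem_reachSet_of_adj (mem_reachSet_self _) (by simp) (hdart d) (hdart _)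
        by_cases h2 : d.snd ∈ T
        · exfalso
          -- With both ends in `T`, an edge leaves just its two darts: an even component.
          have : reachSet (gadget G k) U (.inl d) = {.inl d, .inl d.symm} := by
            refine Set.Subset.antisymm (reachSet_subset (by simp) ?_) ?_
            · rintro _ (rfl | rfl) (e | ⟨w, j⟩) hyz - hz
              · right; exact congrArg Sum.inl hyz
              · obtain rfl : w = d.fst := hyz
                exact absurd ((hmemT _).1 h1 j) hz
              · left
                rw [gadget_inl_inl, Dart.symm_symm] at hyz
                rw [hyz]
              · obtain rfl : w = d.snd := hyz
                exact absurd ((hmemT _).1 h2 j) hz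
            · rintro _ (rfl | rfl)
              · exact mem_reachSet_self _
              · exact hds
          rw [this, Set.ncard_pair (by simpa using d.symm_ne.symm)] at hodd
          exact absurd hodd (by decide)
        · exact hfst _ hC d.symm hds h2
      · exact hfst _ hC d (mem_reachSet_self _) h1
    · exact ⟨v, fun hv => hx ((hmemT v).1 hv i), i, mem_reachSet_self _⟩
  have hlink : ∀ C ∈ oddParts (gadget G k) U, ∀ v ∉ T, ∀ i : Fin (k v), Sum.inr ⟨v, i⟩ ∈ C →
      ∀ w ∈ reachSet G T v, ∀ j : Fin (k w), Sum.inr ⟨w, j⟩ ∈ C := by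
    rintro C ⟨_, x, hx, rfl⟩ v hv i hi w hw
    have key : reachSet G T v ⊆ {w | ∀ j : Fin (k w),
        Sum.inr ⟨w, j⟩ ∈ reachSet (gadget G k) U x} := by
      refine reachSet_subset ?_ ?_
      · intro j
        have hiU := notMem_of_mem_reachSet hx hi
        rw [← reachSet_eq_of_mem hi, hclique v i j hiU (hall v j i hiU)]
        exact mem_reachSet_self _
      · intro y hy z hyz hyT hzT j
        obtain ⟨a, ha⟩ := hnotT y (by simpa using hyT)
        obtain ⟨b, hb⟩ := hnotT z (by simpa using hzT)
        have h1 : Sum.inl ⟨(y, z), hyz⟩ ∈ reachSet (gadget G k) U x :=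
          mem_reachSet_of_adj (hy a) (by simp) ha (hdart _)
        have h2 : Sum.inl (Dart.symm ⟨(y, z), hyz⟩) ∈ reachSet (gadget G k) U x :=
          mem_reachSet_of_adj h1 (by simp) (hdart _) (hdart _)
        exact mem_reachSet_of_adj h2 (by simp) (hdart _) (hall z j b hb)
    exact key hw
  have : Nonempty V := by
    obtain ⟨C, hC⟩ := Set.nonempty_of_ncard_ne_zero (s := oddParts (gadget G k) U) (by omega)
    exact ⟨(hrep C hC).choose⟩
  choose! f hfT hfC using hrep
  have hsame : ∀ C ∈ oddParts (gadget G k) U, ∀ C' ∈ oddParts (gadget G k) U,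
      f C' ∈ reachSet G T (f C) → C = C' := by
    intro C hC C' hC' hr
    obtain ⟨i, hi⟩ := hfC C hC
    obtain ⟨j, hj⟩ := hfC C' hC'
    have hj' := hlink C hC _ (hfT C hC) i hi _ hr j
    obtain ⟨-, x, hx, rfl⟩ := hC
    obtain ⟨-, x', hx', rfl⟩ := hC'
    rw [← reachSet_eq_of_mem hj, ← reachSet_eq_of_mem hj']
  have hfin : (oddParts (gadget G k) U).Finite := Set.toFinite _
  refine ⟨T, hfin.toFinset.image f, ?_, ?_, ?_⟩
  · rw [Finset.disjoint_left]
    intro r hr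
    obtain ⟨C, hC, rfl⟩ := Finset.mem_image.1 hr
    exact hfT C (hfin.mem_toFinset.1 hC)
  · intro r hr r' hr' hrr
    obtain ⟨C, hC, rfl⟩ := Finset.mem_image.1 hr
    obtain ⟨C', hC', rfl⟩ := Finset.mem_image.1 hr'
    rw [hsame C (hfin.mem_toFinset.1 hC) C' (hfin.mem_toFinset.1 hC') hrr]
  · rw [Finset.card_image_of_injOn, ← Set.ncard_eq_toFinset_card _ hfin]
    · refine le_trans (Nat.add_le_add_right ?_ 2) hcard
      have hsub : (((T.sigma fun v => (Finset.univ : Finset (Fin (k v)))).map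
          (Function.Embedding.inr (α := G.Dart)) : Finset _) : Set _) ⊆ U := by
        intro x hx
        obtain ⟨⟨v, i⟩, hv, rfl⟩ := Finset.mem_map.1 (Finset.mem_coe.1 hx)
        exact (hmemT v).1 (Finset.mem_sigma.1 hv).1 i
      have := Set.ncard_le_ncard hsub
      rw [Set.ncard_coe_finset, Finset.card_map, Finset.card_sigma] at this
      simpa using this
    · intro C hC C' hC' hCC
      have hC := hfin.mem_toFinset.1 (Finset.mem_coe.1 hC)
      have hC' := hfin.mem_toFinset.1 (Finset.mem_coe.1 hC')
      exact hsame C hC C' hC' (hCC ▸ mem_reachSet_self _)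

open Classical in
/-- A graph of minimum degree at least two without a strong parity factor has a vertex set `T`
whose removal leaves at least `∑ v ∈ T, (d(v) - 2) + 2` components. -/
theorem exists_separated_of_not_hasStrongParityFactor [Fintype V] {G : SimpleGraph V}
    (hdeg : ∀ v, 2 ≤ G.degree v) (h : ¬ HasStrongParityFactor G) :
    ∃ T R : Finset V, Disjoint R T ∧
      (∀ r ∈ R, ∀ r' ∈ R, r' ∈ reachSet G T r → r = r') ∧
      ∑ v ∈ T, G.degree v + 2 ≤ R.card + 2 * T.card := by
  unfold HasStrongParityFactor at h
  push Not at h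
  obtain ⟨X, hX, hF⟩ := h
  -- Then d(v) - k(v) is 1 on `X` and 2 elsewhere, which gives both the lower bound and the parity
  -- wanted for the degree in `F`.
  let k : V → ℕ := fun v => G.degree v - if v ∈ X then 1 else 2
  have hk : ∀ v, k v + (if v ∈ X then 1 else 2) = G.degree v := fun v => by
    have := hdeg v
    simp only [k]
    split_ifs <;> omega
  have heven : Even (Nat.card (G.Dart ⊕ (Σ v, Fin (k v)))) := by
    rw [card_gadget]
    have h1 : ∑ v, (G.degree v + k v) + ∑ v, (if v ∈ X then 1 else 2)
        = 2 * ∑ v, G.degree v := by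
      rw [← Finset.sum_add_distrib, Finset.mul_sum]
      exact Finset.sum_congr rfl fun v _ => by have := hk v; omega
    have h2 : ∑ v, (if v ∈ X then 1 else 2) + X.card = 2 * Fintype.card V := by
      have : X.card = ∑ v, if v ∈ X then 1 else 0 := by simp
      rw [this, ← Finset.sum_add_distrib, ← Finset.card_univ, Finset.card_eq_sum_ones,
        Finset.mul_sum]
      exact Finset.sum_congr rfl fun v _ => by split_ifs <;> rfl
    obtain ⟨m, hm⟩ := hX
    rw [Nat.even_iff]
    omega
  have hM : ¬ ∃ M : (gadget G k).Subgraph, M.IsPerfectMatching := by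
    rintro ⟨M, hM⟩
    obtain ⟨F, hFG, hFd⟩ := exists_factor_of_isPerfectMatching hM
    obtain ⟨v, hv, hv'⟩ := hF F hFG
      (fun v => by
        have := (hFd v).1
        have := hk v
        split_ifs at this <;> omega)
      (fun v hv => by
        have h1 := (hFd v).2
        have h2 := hk v
        rw [if_pos hv] at h2
        rw [Nat.even_iff] at h1
        rw [Nat.odd_iff]
        omega)
    refine hv' ?_
    have h1 := (hFd v).2
    have h2 := hk v
    rw [if_neg hv] at h2
    rw [Nat.even_iff] at h1 ⊢
    omega
  obtain ⟨T, R, hRT, hsep, hcard⟩ := exists_separated_of_not_isPerfectMatching heven hM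
  refine ⟨T, R, hRT, hsep, ?_⟩
  have : ∑ v ∈ T, G.degree v ≤ ∑ v ∈ T, k v + 2 * T.card := by
    rw [Finset.card_eq_sum_ones, Finset.mul_sum, ← Finset.sum_add_distrib]
    refine Finset.sum_le_sum fun v _ => ?_
    have := hk v
    split_ifs at this <;> omega
  omega

end Separation

/-! ### Counting vertices in the components -/

section Degree

/-- Here s = |T|, D is the degree sum over T, m the number of components, and σ the order of all but
one of them; the omitted one takes at least one of the D edges. The estimate is weakest at s = 1,
since (δ - 2)(δ² - 1) ≥ 2δ for δ ≥ 3. -/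
lemma card_parts_bound {δ s D m σ : ℤ} (hδ : 3 ≤ δ) (hs : 1 ≤ s) (hD : δ * s ≤ D)
    (hm : D + 2 ≤ m + 2 * s) (hσ : (m - 1) * (δ ^ 2 + δ - 1) ≤ (δ - 1) * σ + δ * (D - 1)) :
    δ ^ 2 - 1 ≤ σ := by
  have h1 : 0 ≤ (m - 1 - (δ - 2) * s - 1) * (δ ^ 2 - 1) :=
    mul_nonneg (by nlinarith) (by nlinarith)
  have h2 : 0 ≤ (s - 1) * ((δ - 2) * (δ ^ 2 - 1) - 2 * δ) :=
    mul_nonneg (by linarith) (by nlinarith)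
  have h3 : 0 ≤ δ * (m + 2 * s - 2 - D) := mul_nonneg (by linarith) (by linarith)
  have h4 : 0 ≤ (δ - 1) * (σ - (δ ^ 2 - 1)) := by nlinarith
  have := nonneg_of_mul_nonneg_right h4 (by linarith)
  linarith

/-- A vertex of degree d in T forces m ≥ d + (δ - 2)(s - 1) components, which yields σ ≥ d(δ + 1).
Thus d is roughly at most n / (δ + 1), and n ≥ 2δ² makes this small enough. -/
lemma degree_bound_of_mem {δ s D m σ d n : ℤ} (hδ : 3 ≤ δ) (hs : 1 ≤ s)
    (hd : d + δ * (s - 1) ≤ D) (hm : D + 2 ≤ m + 2 * s)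
    (hσ : m * (δ ^ 2 + δ - 1) ≤ (δ - 1) * σ + δ * D) (hn : s + σ ≤ n) (hn' : 2 * δ ^ 2 ≤ n) :
    d + δ ^ 2 + 2 < n + 2 * δ := by
  have h1 : 0 ≤ (m - d - (δ - 2) * (s - 1)) * (δ ^ 2 - 1) :=
    mul_nonneg (by nlinarith) (by nlinarith)
  have h2 : 0 ≤ (s - 1) * ((δ - 2) * (δ ^ 2 - 1) - 2 * δ) :=
    mul_nonneg (by linarith) (by nlinarith)
  have h3 : 0 ≤ δ * (m + 2 * s - 2 - D) := mul_nonneg (by linarith) (by linarith)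
  have h4 : 0 ≤ (δ - 1) * (σ - d * (δ + 1)) := by nlinarith
  have h5 := nonneg_of_mul_nonneg_right h4 (by linarith)
  by_contra! hcon
  have h6 : (δ + 1) * (n + 2 * δ - δ ^ 2 - 2) ≤ (δ + 1) * d :=
    mul_le_mul_of_nonneg_left (by linarith) (by linarith)
  nlinarith

open Classical in
/-- If removing `T` leaves at least `∑ v ∈ T, (d(v) - 2) + 2` components, then every degree is
smaller than `n - (δ - 1) ^ 2 - 1`. -/
theorem degree_lt_of_separated {V : Type*} [Fintype V] {G : SimpleGraph V} (hconn : G.Connected)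
    {δ : ℕ} (hδ : 3 ≤ δ) (hdeg : ∀ v, δ ≤ G.degree v) (hn : 2 * δ ^ 2 ≤ Fintype.card V)
    {T R : Finset V} (hRT : Disjoint R T)
    (hsep : ∀ r ∈ R, ∀ r' ∈ R, r' ∈ reachSet G T r → r = r')
    (hcard : ∑ v ∈ T, G.degree v + 2 ≤ R.card + 2 * T.card) (x : V) :
    G.degree x + δ ^ 2 + 2 < Fintype.card V + 2 * δ := by
  have hRT' : ∀ r ∈ R, r ∉ (T : Set V) := fun r hr => by
    simpa using Finset.disjoint_left.1 hRT hr
  set C : V → Finset V := fun r => Finset.univ.filter (· ∈ reachSet G T r) with hC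
  have hmemC : ∀ r y, y ∈ C r ↔ y ∈ reachSet G T r := by simp [hC]
  have hCT : ∀ r ∈ R, ∀ y ∈ C r, y ∉ T := fun r hr y hy => by
    simpa using notMem_of_mem_reachSet (hRT' r hr) ((hmemC r y).1 hy)
  have hCdisj : ∀ r ∈ R, ∀ r' ∈ R, ∀ y, y ∈ C r → y ∈ C r' → r = r' := by
    intro r hr r' hr' y hy hy'
    rw [hmemC] at hy hy'
    refine hsep r hr r' hr' ?_
    rw [← reachSet_eq_of_mem hy, reachSet_eq_of_mem hy']
    exact mem_reachSet_self r'
  have hCpair : (R : Set V).PairwiseDisjoint C := fun r hr r' hr' hne =>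
    Finset.disjoint_left.2 fun y hy hy' => hne (hCdisj r hr r' hr' y hy hy')
  have hCadj : ∀ r ∈ R, ∀ y ∈ C r, ∀ z, G.Adj y z → z ∉ T → z ∈ C r := by
    intro r hr y hy z hyz hz
    rw [hmemC] at hy ⊢
    exact mem_reachSet_of_adj hy hyz (notMem_of_mem_reachSet (hRT' r hr) hy) (by simpa using hz)
  have hTne : T.Nonempty := by
    rw [Finset.nonempty_iff_ne_empty]
    rintro rfl
    simp only [Finset.sum_empty, Finset.card_empty] at hcard
    obtain ⟨r, hr, r', hr', hne⟩ := Finset.one_lt_card.1 (by omega : 1 < R.card)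
    obtain ⟨p⟩ := hconn.preconnected r r'
    by_cases hmem : r' ∈ C r
    · exact hne (hsep r hr r' hr' ((hmemC _ _).1 hmem))
    · obtain ⟨d, -, hd1, hd2⟩ := p.exists_boundary_dart (C r : Set V)
        (by simp [hmemC, mem_reachSet_self]) (by simpa using hmem)
      exact hd2 (Finset.mem_coe.2 (hCadj r hr _ (Finset.mem_coe.1 hd1) _ d.adj (by simp)))
  set e : V → ℕ := fun y => (G.neighborFinset y ∩ T).card with he
  set E : V → ℕ := fun r => ∑ y ∈ C r, e y with hE
  have hEsum : ∑ r ∈ R, E r ≤ ∑ t ∈ T, G.degree t := by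
    rw [hE, ← Finset.sum_biUnion hCpair]
    refine (Finset.sum_le_sum_of_subset (Finset.subset_univ _)).trans (le_of_eq ?_)
    have h := Finset.sum_card_bipartiteAbove_eq_sum_card_bipartiteBelow
      (s := (Finset.univ : Finset V)) (t := T) G.Adj
    calc ∑ y, e y = ∑ y, (Finset.bipartiteAbove G.Adj T y).card := by
          refine Finset.sum_congr rfl fun y _ => congrArg Finset.card ?_
          ext t; simp [Finset.bipartiteAbove, and_comm]
      _ = ∑ t ∈ T, (Finset.bipartiteBelow G.Adj Finset.univ t).card := h
      _ = ∑ t ∈ T, G.degree t := by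
          refine Finset.sum_congr rfl fun t _ => ?_
          rw [← card_neighborFinset_eq_degree]
          congr 1
          ext y; simp [Finset.bipartiteBelow, G.adj_comm]
  have hEpos : ∀ r ∈ R, 1 ≤ E r := by
    intro r hr
    obtain ⟨t, ht⟩ := hTne
    obtain ⟨p⟩ := hconn.preconnected r t
    obtain ⟨d, -, hd1, hd2⟩ := p.exists_boundary_dart (C r : Set V)
      (by simp [hmemC, mem_reachSet_self]) (fun h => hCT r hr t (by simpa using h) ht)
    have hd1 := Finset.mem_coe.1 hd1
    have hd2 : d.snd ∉ C r := fun h => hd2 (Finset.mem_coe.2 h)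
    have hsnd : d.snd ∈ T := by
      by_contra hsnd
      exact hd2 (hCadj r hr _ hd1 _ d.adj hsnd)
    have h1 : 1 ≤ e d.fst := Finset.card_pos.2 ⟨d.snd, by simp [hsnd]⟩
    exact h1.trans (Finset.single_le_sum (f := e) (fun _ _ => Nat.zero_le _) hd1)
  have hdegC : ∀ r ∈ R, ∀ y ∈ C r, δ + 1 ≤ (C r).card + e y := by
    intro r hr y hy
    have hsub : G.neighborFinset y ⊆ (C r).erase y ∪ (G.neighborFinset y ∩ T) := by
      intro z hz
      rw [mem_neighborFinset] at hz
      by_cases hzT : z ∈ T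
      · simp [hz, hzT]
      · simp [hCadj r hr y hy z hz hzT, hz.ne']
    have h1 := (Finset.card_le_card hsub).trans (Finset.card_union_le _ _)
    rw [card_neighborFinset_eq_degree, Finset.card_erase_of_mem hy] at h1
    have h2 := hdeg y
    have h3 : 0 < (C r).card := Finset.card_pos.2 ⟨y, hy⟩
    simp only [he]
    omega
  -- In the (|C|, E) plane this is the line through the extreme cases (1, δ) and (δ + 1, 1). If |C|
  -- ≤ δ, then E ≥ |C|(δ + 1 - |C|) ≥ δ; otherwise E ≥ 1 suffices.
  have hlin : ∀ r ∈ R, (δ : ℤ) ^ 2 + δ - 1 ≤ (δ - 1) * (C r).card + δ * E r := by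
    intro r hr
    have hpos : 1 ≤ (C r).card :=
      Finset.card_pos.2 ⟨r, (hmemC r r).2 (mem_reachSet_self r)⟩
    have hE1 := hEpos r hr
    have h1 : (C r).card * (δ + 1) ≤ (C r).card * (C r).card + E r := by
      have := Finset.sum_le_sum (hdegC r hr)
      rwa [Finset.sum_const, smul_eq_mul, Finset.sum_add_distrib, Finset.sum_const,
        smul_eq_mul] at this
    zify at h1 hpos hE1 hδ
    rcases le_or_gt ((C r).card : ℤ) δ with hle | hgt
    · have h2 : (δ : ℤ) ≤ E r := by nlinarith
      nlinarith
    · nlinarith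
  have hlinsum : ∀ R' ⊆ R, (R'.card : ℤ) * ((δ : ℤ) ^ 2 + δ - 1)
      ≤ (δ - 1) * (∑ r ∈ R', (C r).card : ℕ) + δ * (∑ r ∈ R', E r : ℕ) := by
    intro R' hR'
    have := Finset.sum_le_sum fun r hr => hlin r (hR' hr)
    rw [Finset.sum_const, nsmul_eq_mul, Finset.sum_add_distrib, ← Finset.mul_sum,
      ← Finset.mul_sum] at this
    push_cast
    exact this
  have hTdeg : δ * T.card ≤ ∑ t ∈ T, G.degree t := by
    rw [mul_comm, ← smul_eq_mul]
    exact Finset.card_nsmul_le_sum _ _ _ fun t _ => hdeg t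
  have hTpos : 1 ≤ T.card := hTne.card_pos
  by_cases hx : x ∈ T
  · have h1 : G.degree x + δ * (T.card - 1) ≤ ∑ t ∈ T, G.degree t := by
      rw [← Finset.add_sum_erase _ _ hx, ← Finset.card_erase_of_mem hx, mul_comm, ← smul_eq_mul]
      exact Nat.add_le_add_left (Finset.card_nsmul_le_sum _ _ _ fun t _ => hdeg t) _
    have h2 : T.card + ∑ r ∈ R, (C r).card ≤ Fintype.card V := by
      rw [← Finset.card_biUnion hCpair, ← Finset.card_union_of_disjoint]
      · exact Finset.card_le_univ _
      · rw [Finset.disjoint_right]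
        intro y hy
        obtain ⟨r, hr, hyr⟩ := Finset.mem_biUnion.1 hy
        exact hCT r hr y hyr
    have h3 := hlinsum R subset_rfl
    have h4 : (δ : ℤ) * (∑ r ∈ R, E r : ℕ) ≤ δ * (∑ t ∈ T, G.degree t : ℕ) :=
      mul_le_mul_of_nonneg_left (by exact_mod_cast hEsum) (by positivity)
    zify [hTpos] at h1
    zify
    refine degree_bound_of_mem (s := T.card) (D := (∑ t ∈ T, G.degree t : ℕ)) (m := R.card)
      (σ := (∑ r ∈ R, (C r).card : ℕ)) (by exact_mod_cast hδ) (by exact_mod_cast hTpos)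
      (by push_cast; exact h1) (by exact_mod_cast hcard) (by linarith) (by exact_mod_cast h2)
      (by exact_mod_cast hn)
  · have hRne : R.Nonempty := by
      rw [← Finset.card_pos]
      nlinarith
    -- Outside T, `x` has no neighbour in any component but its own. Omitting that one (or any, if
    -- `x` is in none of them) leaves only non-neighbours of `x`.
    obtain ⟨r₀, hr₀, hx₀⟩ : ∃ r₀ ∈ R, ∀ r ∈ R.erase r₀, x ∉ C r := by
      by_cases h : ∃ r ∈ R, x ∈ C r
      · obtain ⟨r, hr, hxr⟩ := h
        refine ⟨r, hr, fun r' hr' hxr' => ?_⟩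
        rw [Finset.mem_erase] at hr'
        exact hr'.1 (hCdisj r' hr'.2 r hr x hxr' hxr)
      · push Not at h
        obtain ⟨r, hr⟩ := hRne
        exact ⟨r, hr, fun r' hr' => h r' (Finset.mem_of_mem_erase hr')⟩
    have hsub : R.erase r₀ ⊆ R := Finset.erase_subset _ _
    have h1 : G.degree x + 1 + ∑ r ∈ R.erase r₀, (C r).card ≤ Fintype.card V := by
      rw [← Finset.card_biUnion (hCpair.subset (by exact_mod_cast hsub)),
        ← card_neighborFinset_eq_degree,
        ← Finset.card_insert_of_notMem (G.notMem_neighborFinset_self x),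
        ← Finset.card_union_of_disjoint]
      · exact Finset.card_le_univ _
      · rw [Finset.disjoint_right]
        intro y hy
        obtain ⟨r, hr, hyr⟩ := Finset.mem_biUnion.1 hy
        rw [Finset.mem_insert, mem_neighborFinset]
        rintro (rfl | hxy)
        · exact hx₀ r hr hyr
        · exact hx₀ r hr (hCadj r (hsub hr) y hyr x hxy.symm hx)
    have h2 := hlinsum _ hsub
    have h3 : ∑ r ∈ R.erase r₀, E r + 1 ≤ ∑ t ∈ T, G.degree t := by
      have := Finset.sum_erase_add R E hr₀
      have := hEpos r₀ hr₀
      omega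
    have h4 : (δ : ℤ) * (∑ r ∈ R.erase r₀, E r : ℕ) ≤ δ * ((∑ t ∈ T, G.degree t : ℕ) - 1) :=
      mul_le_mul_of_nonneg_left (by zify at h3; push_cast; linarith) (by positivity)
    have h5 : ((R.erase r₀).card : ℤ) = R.card - 1 := by
      rw [Finset.card_erase_of_mem hr₀, Nat.cast_sub hRne.card_pos, Nat.cast_one]
    rw [h5] at h2
    have h6 := card_parts_bound (δ := δ) (s := T.card) (D := (∑ t ∈ T, G.degree t : ℕ))
      (m := R.card) (σ := (∑ r ∈ R.erase r₀, (C r).card : ℕ)) (by exact_mod_cast hδ)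
      (by exact_mod_cast hTpos) (by exact_mod_cast hTdeg) (by exact_mod_cast hcard)
      (by linarith)
    zify at h1 hδ ⊢
    push_cast at h6
    linarith

end Degree

/-! ### Bounds on the spectral radius -/

section Spectral

open Classical in
/-- The spectral radius is at most any upper bound for the degrees. -/
theorem rho_le_of_degree_le {V : Type*} [Fintype V] [Nonempty V] (G : SimpleGraph V) {b : ℝ}
    (hb : ∀ v, (G.degree v : ℝ) ≤ b) : rho G ≤ b := by
  -- Gershgorin: the discs are centred at 0 and their radii are the degrees.
  obtain ⟨v, hv⟩ := eigenvalue_mem_ball (rho_isGreatest G).1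
  refine le_trans ?_ (hb v)
  rw [Metric.mem_closedBall, Real.dist_eq] at hv
  have hdiag : G.adjMatrix ℝ v v = 0 := by simp [adjMatrix_apply]
  rw [hdiag, sub_zero] at hv
  refine (le_abs_self _).trans (hv.trans ?_)
  rw [← card_neighborFinset_eq_degree, Finset.card_eq_sum_ones, Nat.cast_sum]
  have : ∀ w ∈ Finset.univ.erase v,
      ‖G.adjMatrix ℝ v w‖ = if w ∈ G.neighborFinset v then 1 else 0 := by
    intro w _
    by_cases h : G.Adj v w <;> simp [adjMatrix_apply, h]
  rw [Finset.sum_congr rfl this, ← Finset.sum_filter, Nat.cast_one]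
  exact Finset.sum_le_sum_of_subset_of_nonneg (fun w hw => (Finset.mem_filter.1 hw).2)
    fun _ _ _ => zero_le_one

open Classical in
/-- The spectral radius is at least `|K| - 1` for each clique `K`. -/
theorem le_rho_of_isClique {V : Type*} [Fintype V] (G : SimpleGraph V) {K : Finset V}
    (hne : K.Nonempty) (hK : G.IsClique (K : Set V)) : (K.card : ℝ) - 1 ≤ rho G := by
  have : Nonempty V := ⟨hne.choose⟩
  set A := G.adjMatrix ℝ with hA
  have hherm : (algebraMap ℝ (Matrix V V ℝ) (rho G) - A).IsHermitian := by
    refine Matrix.IsHermitian.sub ?_ (isHermitian_adjMatrix ℝ G)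
    rw [Matrix.algebraMap_eq_diagonal]
    exact Matrix.isHermitian_diagonal _
  have hpsd : (algebraMap ℝ (Matrix V V ℝ) (rho G) - A).PosSemidef := by
    rw [hherm.posSemidef_iff_eigenvalues_nonneg]
    intro i
    have hi := hherm.eigenvalues_mem_spectrum_real i
    rw [← spectrum.singleton_sub_eq, Set.singleton_sub] at hi
    obtain ⟨μ, hμ, hμi⟩ := hi
    have hle : μ ≤ rho G := (rho_isGreatest G).2 (by
      rw [Set.mem_ofPred_eq, Module.End.hasEigenvalue_iff_mem_spectrum, Matrix.spectrum_toLin']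
      exact hμ)
    simp only at hμi
    rw [← hμi]
    simpa using hle
  -- The Rayleigh quotient of the indicator vector of `K` is |K| - 1.
  set x : V → ℝ := fun v => if v ∈ K then 1 else 0 with hx
  have hpos := hpsd.dotProduct_mulVec_nonneg x
  have hxx : x ⬝ᵥ x = K.card := by simp [hx, dotProduct]
  have hxA : x ⬝ᵥ (A.mulVec x) = K.card * (K.card - 1) := by
    have h1 : ∀ v ∈ K, (A.mulVec x) v = K.card - 1 := by
      intro v hv
      rw [hA, adjMatrix_mulVec_apply]
      simp only [hx, Finset.sum_ite_mem, Finset.sum_const, nsmul_eq_mul, mul_one]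
      have : G.neighborFinset v ∩ K = K.erase v := by
        ext w
        simp only [Finset.mem_inter, mem_neighborFinset, Finset.mem_erase]
        exact ⟨fun h => ⟨h.1.ne', h.2⟩, fun h => ⟨hK hv h.2 h.1.symm, h.2⟩⟩
      rw [this, Finset.card_erase_of_mem hv, Nat.cast_sub hne.card_pos, Nat.cast_one]
    simp only [dotProduct, hx, ite_mul, one_mul, zero_mul, Finset.sum_ite_mem,
      Finset.univ_inter]
    rw [Finset.sum_congr rfl h1, Finset.sum_const, nsmul_eq_mul]
  rw [star_trivial, Matrix.sub_mulVec, dotProduct_sub, hxA, Algebra.algebraMap_eq_smul_one,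
    Matrix.smul_mulVec, Matrix.one_mulVec, dotProduct_smul, hxx, smul_eq_mul] at hpos
  have hKpos : (0 : ℝ) < K.card := by exact_mod_cast hne.card_pos
  nlinarith

/-- The two complete pieces together form a clique of order n - (δ - 1)². -/
theorem le_rho_extremalGraph {n δ : ℕ} (hδ : 3 ≤ δ) (hn : 2 * δ ^ 2 ≤ n) :
    (n : ℝ) - δ ^ 2 + 2 * δ - 2 ≤ rho (extremalGraph n δ) := by
  set K : Finset (Fin δ ⊕ (Fin (n - δ * (δ - 1) - 1) ⊕ Fin (δ * (δ - 2) + 1))) :=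
    Finset.univ.disjSum (Finset.univ.map Function.Embedding.inl) with hKdef
  have hcard : K.card = δ + (n - δ * (δ - 1) - 1) := by simp [hKdef]
  have hne : K.Nonempty := by rw [← Finset.card_pos, hcard]; omega
  have hK : (extremalGraph n δ).IsClique (K : Set _) := by
    rintro (a | a | a) ha (b | b | b) hb hab
    all_goals simp_all [extremalGraph, join, completeGraph]
  refine le_trans (le_of_eq ?_) (le_rho_of_isClique _ hne hK)
  have h1 : n - δ * (δ - 1) - 1 + (δ ^ 2 + 1) = n + δ := by
    obtain ⟨m, rfl⟩ : ∃ m, δ = m + 1 := ⟨δ - 1, by omega⟩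
    have : (m + 1) * (m + 1 - 1) + 1 ≤ n := by rw [Nat.add_sub_cancel]; nlinarith
    rw [Nat.sub_sub]
    have h2 : (m + 1) * (m + 1 - 1) + (m + 1) = (m + 1) ^ 2 := by rw [Nat.add_sub_cancel]; ring
    omega
  have h2 : ((n - δ * (δ - 1) - 1 : ℕ) : ℝ) + (δ ^ 2 + 1) = n + δ := by exact_mod_cast h1
  rw [hcard]
  push_cast [h2]
  linarith

end Spectral

end StrongParity

theorem theorem1p1 {V : Type*} [Fintype V] (G : SimpleGraph V) [DecidableRel G.Adj]
    (n δ : ℕ) (hconn : G.Connected) (hn : Fintype.card V = n) (hδ : G.minDegree = δ)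
    (hδ3 : 3 ≤ δ) (hnδ : 2 * δ ^ 2 ≤ n)
    (hρ : StrongParity.rho (StrongParity.extremalGraph n δ) ≤ StrongParity.rho G) :
    StrongParity.HasStrongParityFactor G ∨ Nonempty (G ≃g StrongParity.extremalGraph n δ) := by
  obtain rfl : ‹DecidableRel G.Adj› = fun a b => Classical.propDecidable (G.Adj a b) :=
    Subsingleton.elim _ _
  classical
  subst hn
  left
  by_contra hF
  have : Nonempty V := hconn.nonempty
  have hdeg : ∀ v, δ ≤ G.degree v := fun v => hδ ▸ G.minDegree_le_degree v
  obtain ⟨T, R, hRT, hsep, hcard⟩ :=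
    StrongParity.exists_separated_of_not_hasStrongParityFactor
      (fun v => (by omega : 2 ≤ δ).trans (hdeg v)) hF
  -- Integrality turns the strict degree bound into a gap of 1 below `le_rho_extremalGraph`.
  have hle : StrongParity.rho G ≤ (Fintype.card V : ℝ) - δ ^ 2 + 2 * δ - 3 := by
    refine StrongParity.rho_le_of_degree_le G fun v => ?_
    have h := Nat.succ_le_of_lt
      (StrongParity.degree_lt_of_separated hconn hδ3 hdeg hnδ hRT hsep hcard v)
    have h' : ((G.degree v + δ ^ 2 + 2 + 1 : ℕ) : ℝ) ≤ ((Fintype.card V + 2 * δ : ℕ) : ℝ) := by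
      exact_mod_cast h
    push_cast at h'
    linarith
  have := StrongParity.le_rho_extremalGraph hδ3 hnδ
  linarith
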